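/- An ordered complex is an abstract simplicial complex (not necessarily finite) whose vertex set carries a partial order that restricts to a total order on every simplex. The product $K\times L$ of ordered complexes has the pairs of vertices as its vertices, with the product order; its simplices are the nonempty finite chains of pairs whose projections to the two factors are simplices. $\operatorname{Sd}^b(K)$ is the $b$-fold barycentric subdivision and $\|K\|$ the geometric realization with the weak topology. Simplicial maps $\varphi,\psi:K\to L$ are contiguous if $\varphi(\sigma)\cup\psi(\sigma)$ is a simplex of $L$ for every simplex $\sigma$ of $K$; they are $c$-contiguous if there are simplicial maps $H_0=\varphi,H_1,\dots,H_c=\psi$ from $K$ to $L$ such that $H_{i-1}$ and $H_i$ are contiguous for $1\le i\le c$. For every $b\ge 0$ fix a simplicial approximation $\operatorname{Sd}^{b+1}(K)\to\operatorname{Sd}^b(K)$ of the identity of $\|K\|$, and let $\iota:\operatorname{Sd}^b(K)\to K$ be the composite of these maps. For simplicial maps $\varphi,\psi:K\to L$ and integers $b,c\ge 0$, the $(b,c)$-simplicial distance $\mathrm{SimpD}^b_c(\varphi,\psi)$ is the least $k\ge 0$ for which there are subcomplexes $J_0,\dots,J_k$ covering $\operatorname{Sd}^b(K)$ such that for every $i$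 the maps $(\varphi\circ\iota)|_{J_i}$ and $(\psi\circ\iota)|_{J_i}$ from $J_i$ to $L$ are $c$-contiguous; it is $\infty$ if there is no such $k$. The $(b,c)$-simplicial complexity $\mathrm{SC}^b_c(K)$ is the least $k\ge 0$ for which there are subcomplexes $J_0,\dots,J_k$ covering $\operatorname{Sd}^b(K\times K)$ such that for every $i$ the composites $J_i\hookrightarrow\operatorname{Sd}^b(K\times K)\xrightarrow{\iota}K\times K\xrightarrow{\mathrm{pr}_j}K$ for $j=1,2$ are $c$-contiguous; it is $\infty$ if there is no such $k$. The (reduced) topological complexity $\mathrm{TC}(X)$ of a space $X$ is the least $k\ge 0$ such that $X\times X$ is covered by open sets $U_0,\dots,U_k$ on each of which the path fibration $\gamma\mapsto(\gamma(0),\gamma(1))$ has a continuous section; it is $\infty$ if there is no such $k$. **Proposition.** Let $K$ be an ordered complex with projections $\mathrm{pr}_1,\mathrm{pr}_2:K\times K\to K$. For every choice of the approximations of the identity on the subdivisions of $K\times K$ (the same choice in both invariants) and for all integers $b,c\ge 0$, $$\mathrm{SimpD}^b_c(\mathrm{pr}_1,\mathrm{pr}_2)=\mathrm{SC}^b_c(K)\qquad\text{and}\qquad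 \mathrm{TC}(\|K\|)\le \mathrm{SimpD}^b_c(\mathrm{pr}_1,\mathrm{pr}_2).$$ -/

import Mathlib

universe u v

/-- An ordered (abstract) simplicial complex, of arbitrary size: a simplicial complex whose vertex
set is partially ordered in such a way that the vertices of every simplex are totally ordered. -/
structure OrderedComplex : Type (u + 1) where
  /-- the vertices -/
  V : Type u
  /-- the partial order of the vertices -/
  order : PartialOrder V
  /-- the simplices (nonempty finite sets of vertices) -/
  complex : AbstractSimplicialComplex V
  isChain : ∀ s ∈ complex.faces, IsChain (· ≤ ·) (s : Set V)

attribute [instance] OrderedComplex.order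

namespace OrderedComplex

noncomputable section

open scoped Classical

/-- `K.faces` is the set of simplices of `K`. -/
abbrev faces (K : OrderedComplex.{u}) : Set (Finset K.V) := K.complex.faces

theorem nonempty_of_mem {K : OrderedComplex.{u}} {s : Finset K.V} (hs : s ∈ K.faces) :
    s.Nonempty :=
  (K.complex.isRelLowerSet_faces hs).1

theorem mem_of_subset {K : OrderedComplex.{u}} {s t : Finset K.V} (hs : s ∈ K.faces)
    (hts : t ⊆ s) (ht : t.Nonempty) : t ∈ K.faces :=
  (K.complex.isRelLowerSet_faces hs).2 hts ht

/-! ### Simplicial maps and contiguity -/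

/-- A simplicial map: a map of vertices that sends simplices to simplices. -/
@[ext]
structure SimplicialMap (K : OrderedComplex.{u}) (L : OrderedComplex.{v}) where
  toFun : K.V → L.V
  image_mem : ∀ s ∈ K.faces, s.image toFun ∈ L.faces

namespace SimplicialMap

/-- The identity map. -/
def id (K : OrderedComplex.{u}) : SimplicialMap K K where
  toFun := fun x => x
  image_mem s hs := by simpa using hs

/-- The composition `g ∘ f`. -/
def comp {K : OrderedComplex.{u}} {L : OrderedComplex.{v}} {M : OrderedComplex}
    (g : SimplicialMap L M) (f : SimplicialMap K L) : SimplicialMap K M where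
  toFun := g.toFun ∘ f.toFun
  image_mem s hs := by
    rw [← Finset.image_image]
    exact g.image_mem _ (f.image_mem s hs)

/-- `φ` and `ψ` are contiguous: `φ(σ) ∪ ψ(σ)` is a simplex for every simplex `σ`. -/
def Contiguous {K : OrderedComplex.{u}} {L : OrderedComplex.{v}} (φ ψ : SimplicialMap K L) :
    Prop :=
  ∀ s ∈ K.faces, s.image φ.toFun ∪ s.image ψ.toFun ∈ L.faces

/-- `φ` and `ψ` are `c`-contiguous: there is a chain `φ = H₀, H₁, …, H_c = ψ` of simplicial maps
in which consecutive ones are contiguous. -/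
def CContiguous {K : OrderedComplex.{u}} {L : OrderedComplex.{v}} (c : ℕ)
    (φ ψ : SimplicialMap K L) : Prop :=
  ∃ H : Fin (c + 1) → SimplicialMap K L,
    H 0 = φ ∧ H (Fin.last c) = ψ ∧ ∀ i : Fin c, Contiguous (H i.castSucc) (H i.succ)

end SimplicialMap

/-! ### Subcomplexes -/

/-- A subcomplex of `K`: a set of simplices of `K` closed under passing to faces. -/
structure Subcomplex (K : OrderedComplex.{u}) where
  carrier : Set (Finset K.V)
  subset : carrier ⊆ K.faces
  down_closed : ∀ s ∈ carrier, ∀ t ⊆ s, t.Nonempty → t ∈ carrier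

namespace Subcomplex

/-- A subcomplex as an ordered complex; its vertices are the vertices of its simplices. -/
abbrev toComplex {K : OrderedComplex.{u}} (J : Subcomplex K) : OrderedComplex.{u} where
  V := {v : K.V // {v} ∈ J.carrier}
  order := inferInstance
  complex :=
    { faces := {s | s.map (Function.Embedding.subtype _) ∈ J.carrier}
      isRelLowerSet_faces := by
        intro s hs
        refine ⟨?_, ?_⟩
        · simpa using nonempty_of_mem (J.subset hs)
        · intro t hts ht
          exact J.down_closed _ hs _ (Finset.map_subset_map.2 hts) (by simpa using ht)
      singleton_mem := fun v => by simpa using v.2 }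
  isChain := by
    intro s hs x hx y hy hxy
    have h := K.isChain _ (J.subset hs)
    exact h (x := x.1) (y := y.1) (by simpa using ⟨x.2, hx⟩) (by simpa using ⟨y.2, hy⟩)
      (fun e => hxy (Subtype.ext e))

/-- The inclusion `J ↪ K`. -/
def incl {K : OrderedComplex.{u}} (J : Subcomplex K) : SimplicialMap J.toComplex K where
  toFun := Subtype.val
  image_mem s hs := by
    have h : s.map (Function.Embedding.subtype _) ∈ K.faces := J.subset hs
    rwa [Finset.map_eq_image] at h

end Subcomplex

/-! ### Products -/

/-- The product of ordered complexes: its vertices are the pairs of vertices with the product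
order, its simplices are the nonempty finite chains of vertices that project to a simplex of each
factor. -/
abbrev prod (K : OrderedComplex.{u}) (L : OrderedComplex.{v}) : OrderedComplex where
  V := K.V × L.V
  order := inferInstance
  complex :=
    { faces := {s | IsChain (· ≤ ·) (s : Set (K.V × L.V)) ∧
        s.image Prod.fst ∈ K.faces ∧ s.image Prod.snd ∈ L.faces}
      isRelLowerSet_faces := by
        rintro s ⟨h, h1, h2⟩
        refine ⟨by simpa using nonempty_of_mem h1, fun t hts ht => ⟨?_, ?_, ?_⟩⟩
        · exact h.mono (Finset.coe_subset.2 hts)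
        · exact mem_of_subset h1 (Finset.image_subset_image hts) (by simpa using ht)
        · exact mem_of_subset h2 (Finset.image_subset_image hts) (by simpa using ht)
      singleton_mem := fun v =>
        ⟨by simp, by simpa using K.complex.singleton_mem v.1,
          by simpa using L.complex.singleton_mem v.2⟩ }
  isChain := fun _ hs => hs.1

/-- The projection `K × L → K`. -/
def prFst (K : OrderedComplex.{u}) (L : OrderedComplex.{v}) : SimplicialMap (K.prod L) K where
  toFun := Prod.fst
  image_mem _ hs := hs.2.1

/-- The projection `K × L → L`. -/
def prSnd (K : OrderedComplex.{u}) (L : OrderedComplex.{v}) : SimplicialMap (K.prod L) L where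
  toFun := Prod.snd
  image_mem _ hs := hs.2.2

/-! ### The barycentric subdivision -/

/-- The barycentric subdivision: its vertices are the simplices of `K`, ordered by inclusion, and
its simplices are the nonempty finite chains. -/
abbrev sd (K : OrderedComplex.{u}) : OrderedComplex.{u} where
  V := {s : Finset K.V // s ∈ K.faces}
  order := inferInstance
  complex :=
    { faces := {A | A.Nonempty ∧
        IsChain (· ≤ ·) (A : Set {s : Finset K.V // s ∈ K.faces})}
      isRelLowerSet_faces := by
        rintro A ⟨h, h1⟩
        exact ⟨h, fun B hB hne => ⟨hne, h1.mono (Finset.coe_subset.2 hB)⟩⟩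
      singleton_mem := fun v => ⟨by simp, by simp⟩ }
  isChain := fun _ hs => hs.2

/-- The iterated subdivision `Sd^b(K)`. -/
def sdIter (K : OrderedComplex.{u}) : ℕ → OrderedComplex.{u}
  | 0 => K
  | b + 1 => (K.sdIter b).sd

/-! ### The geometric realization -/

/-- The underlying set of the geometric realization `‖K‖`: the points are given by their barycentric
coordinates, that is, by nonnegative weights on the vertices whose sum is `1` and whose
support is a simplex. -/
@[ext]
structure Realization (K : OrderedComplex.{u}) : Type u where
  weight : K.V →₀ ℝ
  support_mem : weight.support ∈ K.faces
  nonneg : ∀ w, 0 ≤ weight w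
  sum_eq_one : (weight.sum fun _ a => a) = 1

/-- A finitely supported family of nonnegative weights of sum `1` has nonempty support. -/
theorem support_nonempty {α : Type*} {x : α →₀ ℝ} (h : (x.sum fun _ a => a) = 1) :
    x.support.Nonempty := by
  rw [Finset.nonempty_iff_ne_empty]
  intro h0
  rw [Finsupp.support_eq_empty.1 h0] at h
  simp at h

/-- The point of `‖K‖` with given weights whose support lies in a given simplex. -/
def Realization.ofWeight {K : OrderedComplex.{u}} (x : K.V →₀ ℝ) (s : Finset K.V) (hs : s ∈ K.faces)
    (hx : x.support ⊆ s) (h0 : ∀ w, 0 ≤ x w) (h1 : (x.sum fun _ a => a) = 1) : K.Realization :=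
  ⟨x, mem_of_subset hs hx (support_nonempty h1), h0, h1⟩

/-- The characteristic map of the simplex `s`, from the standard simplex with vertex set `s` onto
the closed simplex `‖s‖ ⊆ ‖K‖`. -/
def Realization.ofSimplex {K : OrderedComplex.{u}} (s : Finset K.V) (hs : s ∈ K.faces)
    (y : stdSimplex ℝ s) : K.Realization :=
  Realization.ofWeight (Finsupp.embDomain (Function.Embedding.subtype (· ∈ s))
      (Finsupp.equivFunOnFinite.symm y.1)) s hs
    (by
      intro w hw
      rw [Finsupp.support_embDomain, Finset.mem_map] at hw
      obtain ⟨a, _, rfl⟩ := hw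
      exact a.2)
    (by
      intro w
      by_cases hw : w ∈ s
      · have h := Finsupp.embDomain_apply_self (Function.Embedding.subtype (· ∈ s))
          (Finsupp.equivFunOnFinite.symm y.1) ⟨w, hw⟩
        change Finsupp.embDomain _ _ w = _ at h
        rw [h]
        exact y.2.1 _
      · rw [Finsupp.embDomain_of_notMem_range]
        rintro ⟨a, rfl⟩
        exact hw a.2)
    (by
      rw [Finsupp.sum_embDomain, Finsupp.sum_fintype _ _ (fun _ => rfl)]
      exact y.2.2)

/-- The topology of `‖K‖` is the coherent (weak) one: a set is open if and only if its intersection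
with every closed simplex is open in that simplex. -/
instance (K : OrderedComplex.{u}) : TopologicalSpace K.Realization :=
  ⨆ s : {s : Finset K.V // s ∈ K.faces},
    TopologicalSpace.coinduced (Realization.ofSimplex s.1 s.2) inferInstance

/-- The map `‖φ‖ : ‖K‖ → ‖L‖` induced by a simplicial map, affine on each simplex. -/
def SimplicialMap.realize {K : OrderedComplex.{u}} {L : OrderedComplex.{v}}
    (φ : SimplicialMap K L) (x : K.Realization) : L.Realization :=
  Realization.ofWeight (x.weight.mapDomain φ.toFun) (x.weight.support.image φ.toFun)
    (φ.image_mem _ x.support_mem) Finsupp.mapDomain_support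
    (by
      intro w
      rw [Finsupp.mapDomain, Finsupp.sum_apply]
      refine Finset.sum_nonneg fun a _ => ?_
      exact Finsupp.single_nonneg.2 (x.nonneg a) w)
    (by
      rw [Finsupp.sum_mapDomain_index (fun _ => rfl) (fun _ _ _ => rfl)]
      exact x.sum_eq_one)

/-- The weights of the barycenter of the simplex `s`. -/
def barycenter {α : Type*} (s : Finset α) : α →₀ ℝ :=
  ∑ w ∈ s, Finsupp.single w ((s.card : ℝ)⁻¹)

theorem barycenter_apply {α : Type*} (s : Finset α) (w : α) :
    barycenter s w = if w ∈ s then ((s.card : ℝ)⁻¹) else 0 := by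
  simp [barycenter, Finsupp.single_apply]

theorem barycenter_sum {α : Type*} (s : Finset α) (hs : s.Nonempty) :
    ((barycenter s).sum fun _ a => a) = 1 := by
  rw [barycenter, ← Finsupp.sum_finsetSum_index (fun _ => rfl) (fun _ _ _ => rfl)]
  have : (s.card : ℝ) ≠ 0 := by exact_mod_cast hs.card_pos.ne'
  simp [this]

/-- A finite nonempty chain of simplices has a largest element. -/
theorem exists_top_of_mem_sd {K : OrderedComplex.{u}} {A : Finset K.sd.V} (hA : A ∈ K.sd.faces) :
    ∃ t ∈ A, ∀ s ∈ A, s.1 ⊆ t.1 := by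
  obtain ⟨t, ht, hmax⟩ := A.exists_max_image (fun s => s.1.card) hA.1
  refine ⟨t, ht, fun s hs => ?_⟩
  rcases eq_or_ne s t with rfl | hne
  · exact subset_rfl
  · rcases hA.2 hs ht hne with h | h
    · exact h
    · exact (Finset.eq_of_subset_of_card_le h (hmax s hs)).symm.subset

/-- The canonical homeomorphism `‖Sd K‖ → ‖K‖` (the identification of the two spaces): it is affine
on each simplex and sends the vertex `s` of `Sd K` to the barycenter of the simplex `s`. -/
def sdRealize {K : OrderedComplex.{u}} (x : K.sd.Realization) : K.Realization :=
  Realization.ofWeight (x.weight.sum fun s a => a • barycenter s.1)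
    (exists_top_of_mem_sd x.support_mem).choose.1 (exists_top_of_mem_sd x.support_mem).choose.2
    (by
      intro w hw
      have htop := (exists_top_of_mem_sd x.support_mem).choose_spec.2
      rw [Finsupp.mem_support_iff, Finsupp.sum_apply] at hw
      obtain ⟨s, hs, hne⟩ := Finset.exists_ne_zero_of_sum_ne_zero hw
      refine htop s hs ?_
      by_contra hws
      exact hne (by simp [barycenter_apply, hws]))
    (by
      intro w
      rw [Finsupp.sum_apply]
      refine Finset.sum_nonneg fun s _ => ?_
      refine mul_nonneg (x.nonneg s) ?_
      rw [barycenter_apply]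
      split_ifs <;> positivity)
    (by
      rw [Finsupp.sum_sum_index (fun _ => rfl) (fun _ _ _ => rfl)]
      rw [← x.sum_eq_one]
      refine Finset.sum_congr rfl fun s _ => ?_
      change (x.weight s • barycenter s.1).sum (fun _ a => a) = x.weight s
      rw [Finsupp.sum_smul_index (fun _ => rfl), ← Finsupp.mul_sum,
        barycenter_sum _ (nonempty_of_mem s.2), mul_one])

/-! ### Simplicial approximations -/

/-- `φ` is a simplicial approximation of `f : ‖K‖ → ‖L‖`: for every point `x`, the point `‖φ‖(x)`
lies in the smallest closed simplex that contains `f(x)`, whose vertex set is the support of the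
barycentric coordinates of `f(x)`. -/
def IsSimplicialApproximation {K : OrderedComplex.{u}} {L : OrderedComplex.{v}}
    (φ : SimplicialMap K L) (f : K.Realization → L.Realization) : Prop :=
  ∀ x : K.Realization, (φ.realize x).weight.support ⊆ (f x).weight.support

/-- A choice, for every `b`, of an approximation `ι : Sd^{b+1}(K) → Sd^b(K)` of the identity
of `‖K‖`. -/
structure ApproxSystem (K : OrderedComplex.{u}) where
  map : ∀ b : ℕ, SimplicialMap (K.sdIter (b + 1)) (K.sdIter b)
  approx : ∀ b : ℕ, IsSimplicialApproximation (map b) (sdRealize (K := K.sdIter b))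

/-- The composite `ι : Sd^b(K) → K` of the chosen approximations. -/
def ApproxSystem.toBase {K : OrderedComplex.{u}} (ι : ApproxSystem K) :
    ∀ b : ℕ, SimplicialMap (K.sdIter b) K
  | 0 => SimplicialMap.id K
  | b + 1 => (ι.toBase b).comp (ι.map b)

/-! ### Simplicial distance and simplicial complexity -/

/-- The subcomplexes `J₀, …, J_k` cover `K`. -/
def Covers {K : OrderedComplex.{u}} {k : ℕ} (J : Fin (k + 1) → Subcomplex K) : Prop :=
  ∀ s ∈ K.faces, ∃ i, s ∈ (J i).carrier

/-- The `(b,c)`-simplicial distance `SimpD^b_c(φ, ψ)`, with value `⊤` when there is no covering as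
required. -/
def simpD {K : OrderedComplex.{u}} {L : OrderedComplex.{v}} (ι : ApproxSystem K) (b c : ℕ)
    (φ ψ : SimplicialMap K L) : ℕ∞ :=
  sInf {n : ℕ∞ | ∃ k : ℕ, n = k ∧ ∃ J : Fin (k + 1) → Subcomplex (K.sdIter b), Covers J ∧
    ∀ i, SimplicialMap.CContiguous c
      ((φ.comp (ι.toBase b)).comp (J i).incl) ((ψ.comp (ι.toBase b)).comp (J i).incl)}

/-- The `(b,c)`-simplicial complexity `SC^b_c(K)`, with value `⊤` when there is no covering as
required. -/
def simplicialComplexity (K : OrderedComplex.{u}) (ι : ApproxSystem (K.prod K)) (b c : ℕ) : ℕ∞ :=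
  sInf {n : ℕ∞ | ∃ k : ℕ, n = k ∧
    ∃ J : Fin (k + 1) → Subcomplex ((K.prod K).sdIter b), Covers J ∧
      ∀ i, SimplicialMap.CContiguous c
        ((prFst K K).comp ((ι.toBase b).comp (J i).incl))
        ((prSnd K K).comp ((ι.toBase b).comp (J i).incl))}

end

end OrderedComplex

/-- The (reduced) topological complexity: the least `k` such that `X × X` is covered by open sets
`U₀, …, U_k` over each of which the path fibration `γ ↦ (γ(0), γ(1))` has a continuous section;
`⊤` if there is no such `k`. The path space carries the compact-open topology. -/
noncomputable def topologicalComplexity (X : Type u) [TopologicalSpace X] : ℕ∞ :=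
  sInf {n : ℕ∞ | ∃ k : ℕ, n = k ∧ ∃ U : Fin (k + 1) → Set (X × X),
    (∀ i, IsOpen (U i)) ∧ (⋃ i, U i) = Set.univ ∧
    ∀ i, ∃ s : C(U i, C(unitInterval, X)), ∀ p : U i, ((s p) 0, (s p) 1) = p.1}

/-!
The equality of the two invariants is associativity of composition. For the inequality let
`X = ‖K‖`. The point to watch is that `X × X` carries the product topology, which for an infinite
complex may be strictly coarser than that of `‖K × K‖`, so that the canonical bijection
`X × X → ‖K × K‖` need not be continuous. A continuous substitute that is correct up to
straight-line homotopy suffices, and it comes from the following two facts.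

* A map into `‖L‖` is continuous as soon as its coordinates are continuous and its supports locally
  lie in one finite set (`Tame.continuous`), and straight-line homotopies between such *tame* maps
  are continuous on any parameter space (`Tame.homotopic`).
* The self-map `concentrate` of `‖L‖`, which lowers all coordinates by half the sum of their
  squares, drops those that become negative and normalises the rest, sends a neighbourhood of each
  point `x₀` into the carrier simplex of `x₀` (`eventually_support_concentrate_subset`). It is
  therefore tame, and it is homotopic to the identity (`homotopic_id_of_support_subset`).

Explicit formulas give `prodPoint : X × X → ‖K × K‖`, to be applied after `concentrate` on both
factors, and `toSd : ‖L‖ → ‖Sd L‖`, which turn tame families into tame families and are compatible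
with carriers of points. They compose to a continuous `coverMap : X × X → ‖Sd^b(K × K)‖`. For a covering by subcomplexes `J i`, let `U i` be the interior
of the set of pairs `(x, y)` for which `r = concentrate (coverMap (x, y))` lies in `‖J i‖`; these
open sets cover `X × X` because of the neighbourhood property of `concentrate`. An approximation of
the identity sends each simplex to one of its vertices (`IsSimplicialApproximation.apply_mem`), so
the first coordinate of `ι r` lies in the carrier of `concentrate x`, and the second one in that of
`concentrate y`. Over `U i` the path from `x` to `y` runs through
`x, concentrate x, H₀ r, …, H_c r, concentrate y, y`, where `H₀, …, H_c` is the chain of contiguous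
maps on `J i`, and each piece is a straight-line homotopy inside a simplex.
-/

namespace OrderedComplex

noncomputable section

open scoped Classical Topology unitInterval
open Filter

/-! ### Continuous functions on a geometric realization -/

theorem continuous_realization_iff {K : OrderedComplex.{u}} {Y : Type*} [TopologicalSpace Y]
    {f : K.Realization → Y} :
    Continuous f ↔ ∀ s hs, Continuous (f ∘ Realization.ofSimplex s hs) := by
  rw [continuous_iSup_dom]
  simp only [continuous_coinduced_dom, Subtype.forall]

theorem continuous_ofSimplex {K : OrderedComplex.{u}} (s : Finset K.V) (hs : s ∈ K.faces) :
    Continuous (Realization.ofSimplex s hs) :=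
  continuous_realization_iff.1 continuous_id s hs

theorem sum_weight_ofSimplex {K : OrderedComplex.{u}} (s : Finset K.V) (hs : s ∈ K.faces)
    (y : stdSimplex ℝ s) (φ : K.V → ℝ → ℝ) (h0 : ∀ v, φ v 0 = 0) :
    (Realization.ofSimplex s hs y).weight.sum φ = ∑ i : s, φ i (y.1 i) := by
  change (Finsupp.embDomain _ _).sum φ = _
  rw [Finsupp.sum_embDomain, Finsupp.sum_fintype _ _ fun i => h0 _]
  rfl

theorem continuous_weight_sum {K : OrderedComplex.{u}} (φ : K.V → ℝ → ℝ) (h0 : ∀ v, φ v 0 = 0)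
    (hφ : ∀ v, Continuous (φ v)) : Continuous fun x : K.Realization => x.weight.sum φ := by
  refine continuous_realization_iff.2 fun s hs => ?_
  have : ((fun x : K.Realization => x.weight.sum φ) ∘ Realization.ofSimplex s hs) =
      fun y => ∑ i : s, φ i (y.1 i) := funext fun y => sum_weight_ofSimplex s hs y φ h0
  rw [this]
  exact continuous_finsetSum _ fun i _ =>
    (hφ i).comp ((continuous_apply i).comp continuous_subtype_val)

theorem continuous_weight {K : OrderedComplex.{u}} (v : K.V) :
    Continuous fun x : K.Realization => x.weight v := by
  have h := continuous_weight_sum (K := K) (fun u a => if u = v then a else 0) (by simp) fun u => by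
    split_ifs
    exacts [continuous_id, continuous_const]
  convert h using 2 with x
  simp [Finsupp.sum, Finset.sum_ite_eq']

theorem support_ofSimplex_subset {K : OrderedComplex.{u}} (s : Finset K.V) (hs : s ∈ K.faces)
    (y : stdSimplex ℝ s) : (Realization.ofSimplex s hs y).weight.support ⊆ s := by
  intro w hw
  change w ∈ (Finsupp.embDomain _ _).support at hw
  rw [Finsupp.support_embDomain, Finset.mem_map] at hw
  obtain ⟨a, _, rfl⟩ := hw
  exact a.2

namespace Realization

variable {K : OrderedComplex.{u}} (x : K.Realization)

theorem sum_weight_eq_one {s : Finset K.V} (h : x.weight.support ⊆ s) :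
    ∑ v ∈ s, x.weight v = 1 := by
  rw [← x.sum_eq_one, Finsupp.sum_of_support_subset _ h _ fun _ _ => rfl]

theorem sum_weight_le_one (s : Finset K.V) : ∑ v ∈ s, x.weight v ≤ 1 := by
  rw [← x.sum_weight_eq_one (Finset.subset_union_right (s₁ := s))]
  exact Finset.sum_le_sum_of_subset_of_nonneg Finset.subset_union_left fun v _ _ => x.nonneg v

theorem weight_pos_iff (v : K.V) : 0 < x.weight v ↔ v ∈ x.weight.support := by
  rw [Finsupp.mem_support_iff]
  exact (x.nonneg v).lt_iff_ne'

theorem sum_pos_of_mem_faces {w : K.V →₀ ℝ} (hw : w.support ∈ K.faces) (h0 : ∀ v, 0 ≤ w v) :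
    0 < w.sum fun _ a => a :=
  Finset.sum_pos (fun v hv => (h0 v).lt_of_ne' (Finsupp.mem_support_iff.1 hv))
    (nonempty_of_mem hw)

/-- The point of `‖K‖` obtained by normalising a family of nonnegative weights whose support is
a simplex. -/
def normalize (w : K.V →₀ ℝ) (hw : w.support ∈ K.faces) (h0 : ∀ v, 0 ≤ w v) : K.Realization :=
  have hpos := sum_pos_of_mem_faces hw h0
  { weight := (w.sum fun _ a => a)⁻¹ • w
    support_mem := by rwa [Finsupp.support_smul_eq (inv_ne_zero hpos.ne')]
    nonneg := fun v => mul_nonneg (inv_nonneg.2 hpos.le) (h0 v)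
    sum_eq_one := by
      rw [Finsupp.sum_smul_index fun _ => rfl, ← Finsupp.mul_sum, inv_mul_cancel₀ hpos.ne'] }

theorem support_normalize (w : K.V →₀ ℝ) (hw : w.support ∈ K.faces) (h0 : ∀ v, 0 ≤ w v) :
    (normalize w hw h0).weight.support = w.support :=
  Finsupp.support_smul_eq (inv_ne_zero (sum_pos_of_mem_faces hw h0).ne')

end Realization

/-! ### Locally finite families of weights -/

/-- A family of finitely supported weights, parametrised by a space, is *tame* if each
coordinate is continuous and locally the supports lie in one finite set. A map into `‖K‖` with tame
weights is continuous, whatever the parameter space is. -/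
structure Tame {Z α : Type*} [TopologicalSpace Z] (w : Z → α →₀ ℝ) : Prop where
  continuous_apply : ∀ a, Continuous fun z => w z a
  locally_finite : ∀ z₀, ∃ F : Finset α, ∀ᶠ z in 𝓝 z₀, (w z).support ⊆ F

namespace Tame

variable {Z Z' α β : Type*} [TopologicalSpace Z] [TopologicalSpace Z'] {w : Z → α →₀ ℝ}

theorem comp (hw : Tame w) {f : Z' → Z} (hf : Continuous f) : Tame fun z => w (f z) where
  continuous_apply a := (hw.continuous_apply a).comp hf
  locally_finite z₀ := by
    obtain ⟨F, hF⟩ := hw.locally_finite (f z₀)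
    exact ⟨F, hf.continuousAt.eventually hF⟩

theorem continuous_sum (hw : Tame w) (φ : α → ℝ → ℝ) (h0 : ∀ a, φ a 0 = 0)
    (hφ : ∀ a, Continuous (φ a)) : Continuous fun z => (w z).sum φ := by
  refine continuous_iff_continuousAt.2 fun z₀ => ?_
  obtain ⟨F, hF⟩ := hw.locally_finite z₀
  have h : Continuous fun z => ∑ a ∈ F, φ a (w z a) :=
    continuous_finsetSum _ fun a _ => (hφ a).comp (hw.continuous_apply a)
  refine h.continuousAt.congr ?_
  filter_upwards [hF] with z hz
  exact (Finsupp.sum_of_support_subset _ hz _ fun a _ => h0 a).symm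

theorem mapDomain (hw : Tame w) (f : α → β) : Tame fun z => (w z).mapDomain f where
  continuous_apply b := by
    have h := hw.continuous_sum (fun a r => Finsupp.single (f a) r b) (by simp) fun a => by
      by_cases hab : f a = b
      · simpa [hab] using continuous_id'
      · simpa [Finsupp.single_eq_of_ne' hab] using continuous_const
    simpa only [Finsupp.mapDomain, Finsupp.sum_apply] using h
  locally_finite z₀ := by
    obtain ⟨F, hF⟩ := hw.locally_finite z₀
    refine ⟨F.image f, hF.mono fun z hz => ?_⟩
    exact Finsupp.mapDomain_support.trans (Finset.image_subset_image hz)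

theorem normalize {K : OrderedComplex.{u}} {w : Z → K.V →₀ ℝ} (hw : Tame w)
    (hs : ∀ z, (w z).support ∈ K.faces) (h0 : ∀ z v, 0 ≤ w z v) :
    Tame fun z => (Realization.normalize (w z) (hs z) (h0 z)).weight where
  continuous_apply v :=
    ((hw.continuous_sum (fun _ a => a) (fun _ => rfl) fun _ => continuous_id).inv₀
      fun z => (Realization.sum_pos_of_mem_faces (hs z) (h0 z)).ne').mul (hw.continuous_apply v)
  locally_finite z₀ := by
    simpa only [Realization.support_normalize] using hw.locally_finite z₀

theorem continuous {K : OrderedComplex.{u}} {f : Z → K.Realization}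
    (hf : Tame fun z => (f z).weight) : Continuous f := by
  -- The sets where the support is a given simplex form a locally finite family, and on the closure
  -- of each of them `f` factors through one closed simplex.
  let A : K.faces → Set Z := fun s => {z | (f z).weight.support = s}
  have hA : LocallyFinite A := by
    intro z₀
    obtain ⟨F, hF⟩ := hf.locally_finite z₀
    refine ⟨_, hF, ?_⟩
    have hfin : {s : K.faces | s.1 ∈ F.powerset}.Finite :=
      F.powerset.finite_toSet.preimage Subtype.val_injective.injOn
    refine hfin.subset ?_
    rintro s ⟨z, hz, hzF⟩
    have hz' : (f z).weight.support = s := hz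
    have hzF' : (f z).weight.support ⊆ F := hzF
    simpa [← hz'] using hzF'
  refine hA.closure.continuous ?_ (fun _ => isClosed_closure) fun s => ?_
  · exact Set.eq_univ_of_forall fun z =>
      Set.mem_iUnion.2 ⟨⟨_, (f z).support_mem⟩, subset_closure rfl⟩
  have hsub : closure (A s) ⊆ {z | ∀ v ∉ s.1, (f z).weight v = 0} := by
    refine closure_minimal ?_ ?_
    · intro z hz v hv
      have hz' : (f z).weight.support = s := hz
      rwa [← hz', Finsupp.notMem_support_iff] at hv
    · simp only [Set.ofPred_forall]
      exact isClosed_iInter fun v => isClosed_iInter fun _ =>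
        isClosed_eq (hf.continuous_apply v) continuous_const
  refine ContinuousOn.mono ?_ hsub
  rw [continuousOn_iff_continuous_domRestrict]
  have hsupp : ∀ z : {z | ∀ v ∉ s.1, (f z).weight v = 0}, (f z).weight.support ⊆ s.1 := by
    intro z v hv
    by_contra h
    exact Finsupp.mem_support_iff.1 hv (z.2 v h)
  let g : {z | ∀ v ∉ s.1, (f z).weight v = 0} → stdSimplex ℝ s.1 := fun z =>
    ⟨fun i => (f z).weight i, fun i => (f z).nonneg i, by
      rw [Finset.sum_coe_sort s.1 fun v => (f z).weight v]
      exact (f z).sum_weight_eq_one (hsupp z)⟩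
  have hg : Continuous g := by
    refine Continuous.subtype_mk ?_ _
    exact continuous_pi fun i => (hf.continuous_apply i).comp continuous_subtype_val
  convert (continuous_ofSimplex s.1 s.2).comp hg using 1
  funext z
  refine Realization.ext (Finsupp.ext fun v => ?_)
  change (f z).weight v = Finsupp.embDomain _ _ v
  by_cases hv : v ∈ s.1
  · exact (Finsupp.embDomain_apply_self (Function.Embedding.subtype (· ∈ s.1))
      (Finsupp.equivFunOnFinite.symm (g z).1) ⟨v, hv⟩).symm
  · rw [Finsupp.embDomain_of_notMem_range]
    · exact z.2 v hv
    · rintro ⟨a, rfl⟩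
      exact hv a.2

end Tame

/-! ### Straight-line homotopies -/

/-- The point `(1 - t) x + t y` of a simplex that contains both `x` and `y`. -/
def Realization.line {K : OrderedComplex.{u}} (x y : K.Realization)
    (h : x.weight.support ∪ y.weight.support ∈ K.faces) (t : I) : K.Realization :=
  Realization.ofWeight ((1 - (t : ℝ)) • x.weight + (t : ℝ) • y.weight) _ h
    (Finsupp.support_add.trans
      (Finset.union_subset_union Finsupp.support_smul Finsupp.support_smul))
    (fun v => add_nonneg (mul_nonneg (sub_nonneg.2 t.2.2) (x.nonneg v))
      (mul_nonneg t.2.1 (y.nonneg v)))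
    (by
      rw [Finsupp.sum_add_index (fun _ _ => rfl) (fun _ _ _ _ => rfl),
        Finsupp.sum_smul_index fun _ => rfl, Finsupp.sum_smul_index fun _ => rfl,
        ← Finsupp.mul_sum, ← Finsupp.mul_sum, x.sum_eq_one, y.sum_eq_one]
      ring)

theorem Realization.weight_line {K : OrderedComplex.{u}} (x y : K.Realization)
    (h : x.weight.support ∪ y.weight.support ∈ K.faces) (t : I) :
    (x.line y h t).weight = (1 - (t : ℝ)) • x.weight + (t : ℝ) • y.weight :=
  rfl

theorem Realization.line_zero {K : OrderedComplex.{u}} (x y : K.Realization)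
    (h : x.weight.support ∪ y.weight.support ∈ K.faces) : x.line y h 0 = x :=
  Realization.ext (by simp [Realization.weight_line])

theorem Realization.line_one {K : OrderedComplex.{u}} (x y : K.Realization)
    (h : x.weight.support ∪ y.weight.support ∈ K.faces) : x.line y h 1 = y :=
  Realization.ext (by simp [Realization.weight_line])

theorem Tame.line {Z : Type*} [TopologicalSpace Z] {K : OrderedComplex.{u}}
    {f g : Z → K.Realization} (hf : Tame fun z => (f z).weight) (hg : Tame fun z => (g z).weight)
    (h : ∀ z, (f z).weight.support ∪ (g z).weight.support ∈ K.faces) {t : Z → I}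
    (ht : Continuous t) : Tame fun z => ((f z).line (g z) (h z) (t z)).weight where
  continuous_apply v :=
    ((continuous_const.sub (continuous_subtype_val.comp ht)).mul (hf.continuous_apply v)).add
      ((continuous_subtype_val.comp ht).mul (hg.continuous_apply v))
  locally_finite z₀ := by
    obtain ⟨F, hF⟩ := hf.locally_finite z₀
    obtain ⟨G, hG⟩ := hg.locally_finite z₀
    refine ⟨F ∪ G, ?_⟩
    filter_upwards [hF, hG] with z hz hz'
    exact (Finsupp.support_add.trans
      (Finset.union_subset_union Finsupp.support_smul Finsupp.support_smul)).trans
      (Finset.union_subset_union hz hz')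

theorem Tame.homotopic {Z : Type*} [TopologicalSpace Z] {K : OrderedComplex.{u}}
    {f g : C(Z, K.Realization)} (hf : Tame fun z => (f z).weight)
    (hg : Tame fun z => (g z).weight)
    (h : ∀ z, (f z).weight.support ∪ (g z).weight.support ∈ K.faces) : f.Homotopic g :=
  ⟨⟨⟨fun p => (f p.2).line (g p.2) (h p.2) p.1,
      ((hf.comp continuous_snd).line (hg.comp continuous_snd) (fun p => h p.2)
        continuous_fst).continuous⟩,
    fun z => Realization.line_zero (f z) (g z) (h z),
    fun z => Realization.line_one (f z) (g z) (h z)⟩⟩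

theorem tame_ofSimplex {K : OrderedComplex.{u}} (s : Finset K.V) (hs : s ∈ K.faces) :
    Tame fun y => (Realization.ofSimplex s hs y).weight :=
  ⟨fun v => (continuous_weight v).comp (continuous_ofSimplex s hs),
    fun _ => ⟨s, Eventually.of_forall (support_ofSimplex_subset s hs)⟩⟩

theorem Tame.const {Z α : Type*} [TopologicalSpace Z] (w : α →₀ ℝ) : Tame fun _ : Z => w :=
  ⟨fun _ => continuous_const, fun _ => ⟨_, Eventually.of_forall fun _ => subset_rfl⟩⟩

/-- A self-map of `‖K‖` that preserves every closed simplex is homotopic to the identity. The identity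
is not tame; instead, the coherent topology of `‖K‖` is used: the homotopy is curried, so that its
continuity can be tested on each simplex. -/
theorem homotopic_id_of_support_subset {K : OrderedComplex.{u}}
    (g : C(K.Realization, K.Realization))
    (h : ∀ x, (g x).weight.support ⊆ x.weight.support) :
    (ContinuousMap.id K.Realization).Homotopic g := by
  have h' : ∀ x : K.Realization, x.weight.support ∪ (g x).weight.support ∈ K.faces := fun x => by
    rw [Finset.union_eq_left.2 (h x)]
    exact x.support_mem
  have key : ∀ (s : Finset K.V) (hs : s ∈ K.faces), Continuous fun p : stdSimplex ℝ s × I =>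
      (Realization.ofSimplex (K := K) s hs p.1).line _ (h' _) p.2 := by
    intro s hs
    have h1 := tame_ofSimplex (K := K) s hs
    have h2 : Tame fun y => (g (Realization.ofSimplex (K := K) s hs y)).weight :=
      ⟨fun v => (continuous_weight v).comp (g.continuous.comp (continuous_ofSimplex s hs)),
        fun _ => ⟨s, Eventually.of_forall fun y =>
          (h _).trans (support_ofSimplex_subset s hs y)⟩⟩
    exact ((h1.comp continuous_fst).line (h2.comp continuous_fst) (fun p => h' _)
      continuous_snd).continuous
  have hline : ∀ x : K.Realization, Continuous fun t : I => x.line (g x) (h' x) t := fun x =>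
    ((Tame.const x.weight).line (Tame.const (g x).weight) (fun _ => h' x) continuous_id).continuous
  let F : C(K.Realization, C(I, K.Realization)) :=
    ⟨fun x => ⟨fun t => x.line (g x) (h' x) t, hline x⟩, continuous_realization_iff.2 fun s hs =>
      ContinuousMap.continuous_of_continuous_uncurry _ (key s hs)⟩
  exact ⟨⟨F.uncurry.comp ContinuousMap.prodSwap, fun x => Realization.line_zero x (g x) (h' x),
    fun x => Realization.line_one x (g x) (h' x)⟩⟩

/-! ### Concentrating a point on its large coordinates -/

namespace Realization

variable {K : OrderedComplex.{u}} {L : OrderedComplex.{v}} (x : K.Realization)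

/-- The sum of the squares of the barycentric coordinates. -/
def normSq : ℝ := x.weight.sum fun _ a => a ^ 2

theorem normSq_pos : 0 < x.normSq :=
  Finset.sum_pos (fun v hv => pow_pos ((x.weight_pos_iff v).2 hv) 2)
    (nonempty_of_mem x.support_mem)

theorem continuous_normSq : Continuous (normSq (K := K)) :=
  continuous_weight_sum (fun _ a => a ^ 2) (fun _ => by simp) fun _ => continuous_pow 2

/-- The sum of the squares is at most the largest coordinate, as the coordinates have sum `1`. -/
theorem exists_half_normSq_lt : ∃ v, x.normSq / 2 < x.weight v := by
  by_contra! h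
  have h1 : x.normSq ≤ ∑ v ∈ x.weight.support, x.normSq / 2 * x.weight v := by
    refine Finset.sum_le_sum fun v _ => ?_
    dsimp only
    rw [pow_two]
    exact mul_le_mul_of_nonneg_right (h v) (x.nonneg v)
  rw [← Finset.mul_sum, x.sum_weight_eq_one subset_rfl] at h1
  linarith [x.normSq_pos]

/-- The unnormalised weights `max (x_v - ‖x‖² / 2) 0` of `concentrate x`. -/
def concentrateWeight : K.V →₀ ℝ :=
  x.weight.mapRange (fun a => max (a - x.normSq / 2) 0)
    (by have := x.normSq_pos; simp; linarith)

theorem concentrateWeight_apply (v : K.V) :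
    x.concentrateWeight v = max (x.weight v - x.normSq / 2) 0 :=
  Finsupp.mapRange_apply ..

theorem mem_support_concentrateWeight (v : K.V) :
    v ∈ x.concentrateWeight.support ↔ x.normSq / 2 < x.weight v := by
  rw [Finsupp.mem_support_iff, concentrateWeight_apply, ne_eq, max_eq_right_iff, not_le, sub_pos]

theorem support_concentrateWeight_subset : x.concentrateWeight.support ⊆ x.weight.support :=
  Finsupp.support_mapRange

theorem support_concentrateWeight_mem : x.concentrateWeight.support ∈ K.faces := by
  obtain ⟨v, hv⟩ := x.exists_half_normSq_lt
  exact mem_of_subset x.support_mem x.support_concentrateWeight_subset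
    ⟨v, (x.mem_support_concentrateWeight v).2 hv⟩

/-- The point of `‖K‖` with weights proportional to `max (x_v - ‖x‖² / 2) 0`, where `‖x‖²` is the
sum of the squares of the coordinates of `x`. -/
def concentrate : K.Realization :=
  normalize x.concentrateWeight x.support_concentrateWeight_mem fun v => by
    rw [concentrateWeight_apply]
    exact le_max_right _ _

theorem support_concentrate : x.concentrate.weight.support = x.concentrateWeight.support :=
  support_normalize ..

theorem support_concentrate_subset : x.concentrate.weight.support ⊆ x.weight.support :=
  x.support_concentrate.trans_subset x.support_concentrateWeight_subset

/-- A whole neighbourhood of `x₀` is mapped by `concentrate` into the carrier simplex of `x₀`. -/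
theorem eventually_support_concentrate_subset (x₀ : K.Realization) :
    ∀ᶠ x in 𝓝 x₀, x.concentrate.weight.support ⊆ x₀.weight.support := by
  have h0 := x₀.normSq_pos
  have h1 : ∀ᶠ x : K.Realization in 𝓝 x₀, x₀.normSq / 2 < x.normSq :=
    continuous_normSq.continuousAt.eventually (lt_mem_nhds (half_lt_self h0))
  have hc : Continuous fun x : K.Realization => ∑ v ∈ x₀.weight.support, x.weight v :=
    continuous_finsetSum _ fun v _ => continuous_weight v
  have h2 : ∀ᶠ x : K.Realization in 𝓝 x₀,
      1 - x₀.normSq / 4 < ∑ v ∈ x₀.weight.support, x.weight v := by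
    refine hc.continuousAt.eventually (lt_mem_nhds ?_)
    dsimp only
    rw [x₀.sum_weight_eq_one subset_rfl]
    linarith
  filter_upwards [h1, h2] with x hx1 hx2 v hv
  rw [support_concentrate, mem_support_concentrateWeight] at hv
  by_contra hvs
  have h3 := x.sum_weight_le_one (insert v x₀.weight.support)
  rw [Finset.sum_insert hvs] at h3
  linarith

theorem tame_concentrate : Tame fun x : K.Realization => x.concentrate.weight := by
  refine Tame.normalize ⟨fun v => ?_, fun x₀ => ⟨x₀.weight.support, ?_⟩⟩ _ _
  · simp only [concentrateWeight_apply]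
    exact ((continuous_weight v).sub (continuous_normSq.div_const 2)).max continuous_const
  · simpa only [support_concentrate] using eventually_support_concentrate_subset x₀

/-! ### From a product of realizations to the realization of the product -/

/-- The total weight of the vertices below `v`, including `v`. -/
def weightLE (v : K.V) : ℝ := x.weight.sum fun u a => if u ≤ v then a else 0

/-- The total weight of the vertices strictly below `v`. -/
def weightLT (v : K.V) : ℝ := x.weight.sum fun u a => if u < v then a else 0

theorem continuous_weightLE (v : K.V) : Continuous fun x : K.Realization => x.weightLE v :=
  continuous_weight_sum (fun u a => if u ≤ v then a else 0) (by simp) fun u => by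
    split_ifs
    exacts [continuous_id, continuous_const]

theorem continuous_weightLT (v : K.V) : Continuous fun x : K.Realization => x.weightLT v :=
  continuous_weight_sum (fun u a => if u < v then a else 0) (by simp) fun u => by
    split_ifs
    exacts [continuous_id, continuous_const]

theorem weightLE_eq (v : K.V) : x.weightLE v = x.weightLT v + x.weight v := by
  have h : x.weight v = x.weight.sum fun u a => if u = v then a else 0 := by
    simp [Finsupp.sum, Finset.sum_ite_eq']
  rw [h, weightLE, weightLT, ← Finsupp.sum_add]
  refine Finset.sum_congr rfl fun u _ => ?_
  rcases eq_or_ne u v with rfl | huv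
  · simp
  · simp [huv, le_iff_lt_or_eq]

theorem weightLE_le_weightLT {u v : K.V} (huv : u < v) : x.weightLE u ≤ x.weightLT v := by
  refine Finset.sum_le_sum fun w _ => ?_
  have := x.nonneg w
  dsimp only
  split_ifs with h1 h2 h2
  · exact le_rfl
  · exact absurd (h1.trans_lt huv) h2
  · exact this
  · exact le_rfl

theorem exists_weightLT_eq_zero : ∃ v, 0 < x.weight v ∧ x.weightLT v = 0 := by
  obtain ⟨v, hv⟩ := x.weight.support.exists_minimal (nonempty_of_mem x.support_mem)
  refine ⟨v, (x.weight_pos_iff v).2 hv.1, Finset.sum_eq_zero fun u hu => if_neg fun huv => ?_⟩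
  exact hv.not_lt hu huv

/-- The unnormalised weights of `prodPoint x y`: the weight of `(v, w)` is the length of the overlap
of the intervals `[weightLT v, weightLE v]` and `[weightLT w, weightLE w]`. -/
def prodWeight (y : L.Realization) : K.V × L.V →₀ ℝ :=
  Finsupp.onFinset (x.weight.support ×ˢ y.weight.support)
    (fun p => max (min (x.weightLE p.1) (y.weightLE p.2) -
      max (x.weightLT p.1) (y.weightLT p.2)) 0)
    (fun p hp => by
      rw [ne_eq, max_eq_right_iff, not_le, sub_pos, max_lt_iff, lt_min_iff, lt_min_iff,
        weightLE_eq, weightLE_eq] at hp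
      rw [Finset.mem_product, ← weight_pos_iff, ← weight_pos_iff]
      constructor <;> linarith [hp.1.1, hp.2.2])

variable (y : L.Realization)

theorem prodWeight_apply (p : K.V × L.V) : x.prodWeight y p =
    max (min (x.weightLE p.1) (y.weightLE p.2) - max (x.weightLT p.1) (y.weightLT p.2)) 0 :=
  rfl

theorem prodWeight_nonneg (p : K.V × L.V) : 0 ≤ x.prodWeight y p :=
  le_max_right _ _

theorem mem_support_prodWeight (p : K.V × L.V) : p ∈ (x.prodWeight y).support ↔
    (x.weightLT p.1 < x.weightLE p.1 ∧ x.weightLT p.1 < y.weightLE p.2) ∧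
      y.weightLT p.2 < x.weightLE p.1 ∧ y.weightLT p.2 < y.weightLE p.2 := by
  rw [Finsupp.mem_support_iff, prodWeight_apply, ne_eq, max_eq_right_iff, not_le, sub_pos,
    max_lt_iff, lt_min_iff, lt_min_iff]

theorem support_prodWeight_subset :
    (x.prodWeight y).support ⊆ x.weight.support ×ˢ y.weight.support :=
  Finsupp.support_onFinset_subset

theorem support_prodWeight_mem : (x.prodWeight y).support ∈ (K.prod L).faces := by
  have hsub : ∀ p ∈ (x.prodWeight y).support, p.1 ∈ x.weight.support ∧ p.2 ∈ y.weight.support :=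
    fun p hp => Finset.mem_product.1 (x.support_prodWeight_subset y hp)
  have hne : (x.prodWeight y).support.Nonempty := by
    obtain ⟨v, hv, hv0⟩ := x.exists_weightLT_eq_zero
    obtain ⟨w, hw, hw0⟩ := y.exists_weightLT_eq_zero
    refine ⟨(v, w), (x.mem_support_prodWeight y _).2 ?_⟩
    simp only [weightLE_eq, hv0, hw0, zero_add]
    exact ⟨⟨hv, hw⟩, hv, hw⟩
  refine ⟨?_, mem_of_subset x.support_mem ?_ (hne.image _),
    mem_of_subset y.support_mem ?_ (hne.image _)⟩
  -- If `v < v'` and `w' < w`, then the intervals of `v`, `v'` and those of `w'`, `w` lie in opposite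
  -- orders, so `v` cannot overlap with `w` while `v'` overlaps with `w'`.
  · rintro ⟨v, w⟩ hp ⟨v', w'⟩ hp' -
    have h := (x.mem_support_prodWeight y _).1 hp
    have h' := (x.mem_support_prodWeight y _).1 hp'
    have hvv := K.isChain _ x.support_mem |>.total (hsub _ hp).1 (hsub _ hp').1
    have hww := L.isChain _ y.support_mem |>.total (hsub _ hp).2 (hsub _ hp').2
    dsimp only at h h' hvv hww
    rcases hvv with hv | hv <;> rcases hww with hw | hw
    · exact Or.inl ⟨hv, hw⟩
    · rcases hv.eq_or_lt with rfl | hv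
      · exact Or.inr ⟨le_rfl, hw⟩
      rcases hw.eq_or_lt with rfl | hw
      · exact Or.inl ⟨hv.le, le_rfl⟩
      linarith [x.weightLE_le_weightLT hv, y.weightLE_le_weightLT hw, h.2.1, h'.1.2]
    · rcases hv.eq_or_lt with rfl | hv
      · exact Or.inl ⟨le_rfl, hw⟩
      rcases hw.eq_or_lt with rfl | hw
      · exact Or.inr ⟨hv.le, le_rfl⟩
      linarith [x.weightLE_le_weightLT hv, y.weightLE_le_weightLT hw, h.1.2, h'.2.1]
    · exact Or.inr ⟨hv, hw⟩
  · exact Finset.image_subset_iff.2 fun p hp => (hsub p hp).1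
  · exact Finset.image_subset_iff.2 fun p hp => (hsub p hp).2

/-- The point of `‖K × L‖` that corresponds to `(x, y)`. -/
def prodPoint : (K.prod L).Realization :=
  normalize (x.prodWeight y) (x.support_prodWeight_mem y) (x.prodWeight_nonneg y)

theorem support_prodPoint_subset :
    (x.prodPoint y).weight.support ⊆ x.weight.support ×ˢ y.weight.support :=
  (support_normalize ..).trans_subset (x.support_prodWeight_subset y)

theorem tame_prodPoint {Z : Type*} [TopologicalSpace Z] {f : Z → K.Realization}
    {g : Z → L.Realization} (hf : Tame fun z => (f z).weight) (hg : Tame fun z => (g z).weight) :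
    Tame fun z => ((f z).prodPoint (g z)).weight := by
  refine Tame.normalize ⟨fun p => ?_, fun z₀ => ?_⟩ _ _
  · exact ((((continuous_weightLE p.1).comp hf.continuous).min
      ((continuous_weightLE p.2).comp hg.continuous)).sub
      (((continuous_weightLT p.1).comp hf.continuous).max
      ((continuous_weightLT p.2).comp hg.continuous))).max continuous_const
  · obtain ⟨F, hF⟩ := hf.locally_finite z₀
    obtain ⟨G, hG⟩ := hg.locally_finite z₀
    refine ⟨F ×ˢ G, ?_⟩
    filter_upwards [hF, hG] with z hz hz'
    exact (support_prodWeight_subset _ _).trans (Finset.product_subset_product hz hz')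

/-! ### From a realization to the realization of the subdivision -/

/-- The weight, before normalisation, of the vertex `s` of the subdivision in `toSd x`: the positive
part of `min_{v ∈ s} x_v - ∑_{w ∉ s} x_w`, written with the coordinates in `s` only. -/
def faceWeight (s : K.sd.V) : ℝ :=
  max (s.1.inf' (nonempty_of_mem s.2) x.weight + ∑ v ∈ s.1, x.weight v - 1) 0

theorem faceWeight_ne_zero {s : K.sd.V} :
    x.faceWeight s ≠ 0 ↔ ∀ v ∈ s.1, 1 - ∑ w ∈ s.1, x.weight w < x.weight v := by
  rw [ne_eq, faceWeight, max_eq_right_iff, not_le, sub_pos, ← sub_lt_iff_lt_add, Finset.lt_inf'_iff]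

/-- This makes the simplices of nonzero weight a chain. -/
theorem weight_lt_of_faceWeight_ne_zero {s : K.sd.V} (hs : x.faceWeight s ≠ 0) {v w : K.V}
    (hv : v ∈ s.1) (hw : w ∉ s.1) : x.weight w < x.weight v := by
  have h1 := x.sum_weight_le_one (insert w s.1)
  rw [Finset.sum_insert hw] at h1
  linarith [x.faceWeight_ne_zero.1 hs v hv]

theorem subset_support_of_faceWeight_ne_zero {s : K.sd.V} (hs : x.faceWeight s ≠ 0) :
    s.1 ⊆ x.weight.support := fun v hv => by
  rw [← weight_pos_iff]
  linarith [x.faceWeight_ne_zero.1 hs v hv, x.sum_weight_le_one s.1]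

/-- The family of the numbers `faceWeight`. -/
def sdWeight : K.sd.V →₀ ℝ :=
  Finsupp.onFinset (x.weight.support.powerset.subtype (· ∈ K.faces)) x.faceWeight fun s hs => by
    rw [Finset.mem_subtype, Finset.mem_powerset]
    exact x.subset_support_of_faceWeight_ne_zero hs

theorem sdWeight_nonneg (s : K.sd.V) : 0 ≤ x.sdWeight s :=
  le_max_right _ _

theorem mem_support_sdWeight (s : K.sd.V) : s ∈ x.sdWeight.support ↔ x.faceWeight s ≠ 0 :=
  Finsupp.mem_support_iff

theorem support_sdWeight_mem : x.sdWeight.support ∈ K.sd.faces := by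
  refine ⟨⟨⟨x.weight.support, x.support_mem⟩, ?_⟩, fun s hs t ht _ => ?_⟩
  · rw [mem_support_sdWeight, faceWeight_ne_zero]
    intro v hv
    rw [x.sum_weight_eq_one subset_rfl, sub_self]
    exact (x.weight_pos_iff v).2 hv
  · have hs' := (x.mem_support_sdWeight s).1 hs
    have ht' := (x.mem_support_sdWeight t).1 ht
    by_contra! h
    obtain ⟨v, hvs, hvt⟩ := Finset.not_subset.1 h.1
    obtain ⟨w, hwt, hws⟩ := Finset.not_subset.1 h.2
    exact lt_asymm (x.weight_lt_of_faceWeight_ne_zero hs' hvs hws)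
      (x.weight_lt_of_faceWeight_ne_zero ht' hwt hvt)

/-- A point of `‖Sd K‖` lying, under the identification with `‖K‖`, in the carrier simplex of `x`:
the vertex `s` has weight proportional to `faceWeight s`. It need not correspond to `x` itself. -/
def toSd : K.sd.Realization :=
  normalize x.sdWeight x.support_sdWeight_mem x.sdWeight_nonneg

theorem subset_support_of_mem_support_toSd {s : K.sd.V} (hs : s ∈ x.toSd.weight.support) :
    s.1 ⊆ x.weight.support := by
  rw [toSd, support_normalize, mem_support_sdWeight] at hs
  exact x.subset_support_of_faceWeight_ne_zero hs

theorem tame_toSd {Z : Type*} [TopologicalSpace Z] {f : Z → K.Realization}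
    (hf : Tame fun z => (f z).weight) : Tame fun z => (f z).toSd.weight := by
  refine Tame.normalize ⟨fun s => ?_, fun z₀ => ?_⟩ _ _
  · exact (((Continuous.finset_inf'_apply (nonempty_of_mem s.2)
      fun v _ => hf.continuous_apply v).add
      (continuous_finsetSum _ fun v _ => hf.continuous_apply v)).sub continuous_const).max
      continuous_const
  · obtain ⟨F, hF⟩ := hf.locally_finite z₀
    refine ⟨F.powerset.subtype (· ∈ K.faces), hF.mono fun z hz s hs => ?_⟩
    rw [Finset.mem_subtype, Finset.mem_powerset]
    exact ((f z).subset_support_of_faceWeight_ne_zero (((f z).mem_support_sdWeight s).1 hs)).trans hz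

/-- The iterate of `toSd`. -/
def toSdIter : ∀ b : ℕ, K.Realization → (K.sdIter b).Realization
  | 0 => fun x => x
  | b + 1 => fun x => (toSdIter b x).toSd

theorem tame_toSdIter {Z : Type*} [TopologicalSpace Z] {f : Z → K.Realization}
    (hf : Tame fun z => (f z).weight) : ∀ b, Tame fun z => (toSdIter b (f z)).weight
  | 0 => hf
  | b + 1 => tame_toSd (tame_toSdIter hf b)

end Realization

/-! ### Approximations of the identity and carriers -/

theorem SimplicialMap.support_realize {K : OrderedComplex.{u}} {L : OrderedComplex.{v}}
    (φ : SimplicialMap K L) (x : K.Realization) :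
    (φ.realize x).weight.support = x.weight.support.image φ.toFun := by
  refine Finsupp.mapDomain_support.antisymm fun w hw => ?_
  obtain ⟨v, hv, rfl⟩ := Finset.mem_image.1 hw
  rw [Finsupp.mem_support_iff, Finsupp.mapDomain, Finsupp.sum_apply]
  refine (Finset.sum_pos' (fun u _ => Finsupp.single_nonneg.2 (x.nonneg u) _) ⟨v, hv, ?_⟩).ne'
  rw [Finsupp.single_eq_same]
  exact (x.weight_pos_iff v).2 hv

/-- An approximation `Sd K → K` of the identity sends each simplex to one of its vertices. -/
theorem IsSimplicialApproximation.apply_mem {K : OrderedComplex.{u}} {φ : SimplicialMap K.sd K}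
    (hφ : IsSimplicialApproximation φ (sdRealize (K := K))) (s : K.sd.V) : φ.toFun s ∈ s.1 := by
  let x : K.sd.Realization :=
    { weight := Finsupp.single s 1
      support_mem := by
        rw [Finsupp.support_single s one_ne_zero]
        exact K.sd.complex.singleton_mem s
      nonneg := fun v => Finsupp.single_nonneg.2 zero_le_one v
      sum_eq_one := Finsupp.sum_single_index rfl }
  have h := hφ x
  rw [SimplicialMap.support_realize] at h
  have hs : s ∈ x.weight.support := by simp [x]
  have h1 := h (Finset.mem_image_of_mem _ hs)
  have h2 : (sdRealize x).weight = barycenter s.1 := by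
    change (Finsupp.single s (1 : ℝ)).sum (fun s a => a • barycenter s.1) = _
    rw [Finsupp.sum_single_index (zero_smul ℝ (barycenter s.1)), one_smul]
  rw [h2, Finsupp.mem_support_iff, barycenter_apply] at h1
  by_contra h3
  exact h1 (if_neg h3)

theorem ApproxSystem.toBase_mem_support {K : OrderedComplex.{u}} (ι : ApproxSystem K)
    (x : K.Realization) : ∀ (b : ℕ) (v : (K.sdIter b).V),
      v ∈ (Realization.toSdIter b x).weight.support → (ι.toBase b).toFun v ∈ x.weight.support
  | 0, _, hv => hv
  | b + 1, v, hv => ι.toBase_mem_support x b _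
      (Realization.subset_support_of_mem_support_toSd _ hv ((ι.approx b).apply_mem v))

/-! ### Points of a subcomplex -/

/-- A point of `‖K‖` whose carrier simplex lies in the subcomplex `J`, as a point of `‖J‖`. -/
def Subcomplex.restrict {K : OrderedComplex.{u}} (J : Subcomplex K) (x : K.Realization)
    (hx : x.weight.support ∈ J.carrier) : J.toComplex.Realization :=
  have hJ : ∀ v ∈ x.weight.support, {v} ∈ J.carrier := fun v hv =>
    J.down_closed _ hx _ (Finset.singleton_subset_iff.2 hv) (Finset.singleton_nonempty v)
  { weight := x.weight.subtypeDomain fun v => {v} ∈ J.carrier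
    support_mem := by
      change Finset.map _ _ ∈ J.carrier
      rwa [Finsupp.support_subtypeDomain, Finset.subtype_map, Finset.filter_true_of_mem hJ]
    nonneg := fun v => x.nonneg v
    sum_eq_one := by
      rw [← x.sum_eq_one]
      exact Finsupp.sum_subtypeDomain_index (h := fun _ a => a) hJ }

theorem Subcomplex.mem_support_restrict {K : OrderedComplex.{u}} (J : Subcomplex K)
    (x : K.Realization) (hx : x.weight.support ∈ J.carrier) (v : J.toComplex.V) :
    v ∈ (J.restrict x hx).weight.support ↔ v.1 ∈ x.weight.support := by
  rw [Finsupp.mem_support_iff, Finsupp.mem_support_iff]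
  rfl

theorem Subcomplex.tame_restrict {K : OrderedComplex.{u}} (J : Subcomplex K) {Z : Type*}
    [TopologicalSpace Z] {f : Z → K.Realization} (hf : Tame fun z => (f z).weight)
    (hJ : ∀ z, (f z).weight.support ∈ J.carrier) :
    Tame fun z => (J.restrict (f z) (hJ z)).weight where
  continuous_apply v := hf.continuous_apply v.1
  locally_finite z₀ := by
    obtain ⟨F, hF⟩ := hf.locally_finite z₀
    refine ⟨F.subtype _, hF.mono fun z hz v hv => ?_⟩
    exact Finset.mem_subtype.2 (hz ((J.mem_support_restrict _ (hJ z) v).1 hv))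

/-! ### Contiguity and homotopy -/

theorem SimplicialMap.tame_realize {K : OrderedComplex.{u}} {L : OrderedComplex.{v}}
    (φ : SimplicialMap K L) {Z : Type*} [TopologicalSpace Z] {f : Z → K.Realization}
    (hf : Tame fun z => (f z).weight) : Tame fun z => (φ.realize (f z)).weight :=
  hf.mapDomain φ.toFun

theorem SimplicialMap.CContiguous.homotopic {K : OrderedComplex.{u}} {L : OrderedComplex.{v}}
    {c : ℕ} {φ ψ : SimplicialMap K L} (h : CContiguous c φ ψ) {Z : Type*} [TopologicalSpace Z]
    {f : Z → K.Realization} (hf : Tame fun z => (f z).weight) :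
    ContinuousMap.Homotopic ⟨fun z => φ.realize (f z), (φ.tame_realize hf).continuous⟩
      ⟨fun z => ψ.realize (f z), (ψ.tame_realize hf).continuous⟩ := by
  obtain ⟨H, rfl, rfl, hH⟩ := h
  let G : Fin (c + 1) → C(Z, L.Realization) := fun i =>
    ⟨fun z => (H i).realize (f z), ((H i).tame_realize hf).continuous⟩
  change (G 0).Homotopic (G (Fin.last c))
  refine Fin.induction (motive := fun i => (G 0).Homotopic (G i)) (.refl _) (fun i hi => ?_) _
  refine hi.trans (Tame.homotopic ((H _).tame_realize hf) ((H _).tame_realize hf) fun z => ?_)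
  change ((H _).realize (f z)).weight.support ∪ ((H _).realize (f z)).weight.support ∈ L.faces
  rw [support_realize, support_realize]
  exact hH i _ (f z).support_mem

/-! ### Motion planners from coverings by subcomplexes -/

/-- The map `‖K‖ × ‖K‖ → ‖Sd^b(K × K)‖` along which the coverings are pulled back. Without
`concentrate` it would not be continuous in general, as `‖K‖ × ‖K‖` has the product topology. -/
def coverMap (K : OrderedComplex.{u}) (b : ℕ) (p : K.Realization × K.Realization) :
    ((K.prod K).sdIter b).Realization :=
  Realization.toSdIter b (p.1.concentrate.prodPoint p.2.concentrate)

theorem tame_coverMap (K : OrderedComplex.{u}) (b : ℕ) :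
    Tame fun p => (K.coverMap b p).weight :=
  Realization.tame_toSdIter (Realization.tame_prodPoint
    (Realization.tame_concentrate.comp continuous_fst)
    (Realization.tame_concentrate.comp continuous_snd)) b

theorem toBase_mem_of_mem_support_coverMap {K : OrderedComplex.{u}} (ι : ApproxSystem (K.prod K))
    {b : ℕ} {p : K.Realization × K.Realization} {v : ((K.prod K).sdIter b).V}
    (hv : v ∈ (K.coverMap b p).concentrate.weight.support) :
    ((ι.toBase b).toFun v).1 ∈ p.1.concentrate.weight.support ∧
      ((ι.toBase b).toFun v).2 ∈ p.2.concentrate.weight.support :=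
  Finset.mem_product.1 (Realization.support_prodPoint_subset _ _
    (ι.toBase_mem_support _ b v (Realization.support_concentrate_subset _ hv)))

/-- A homotopy between the two projections on a subspace of `X × X` is a section of the path
fibration. -/
theorem exists_section_of_homotopic {X : Type*} [TopologicalSpace X] {U : Set (X × X)}
    {f g : C(U, X)} (hf : ∀ p, f p = p.1.1) (hg : ∀ p, g p = p.1.2) (h : f.Homotopic g) :
    ∃ s : C(U, C(I, X)), ∀ p : U, ((s p) 0, (s p) 1) = p.1 := by
  obtain ⟨H⟩ := h
  refine ⟨(H.toContinuousMap.comp ContinuousMap.prodSwap).curry, fun p => ?_⟩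
  have h0 : H (0, p) = p.1.1 := by rw [H.apply_zero, hf]
  have h1 : H (1, p) = p.1.2 := by rw [H.apply_one, hg]
  exact Prod.ext h0 h1

theorem topologicalComplexity_le_of_covers {K : OrderedComplex.{u}} (ι : ApproxSystem (K.prod K))
    {b c k : ℕ} (J : Fin (k + 1) → Subcomplex ((K.prod K).sdIter b)) (hJ : Covers J)
    (hc : ∀ i, SimplicialMap.CContiguous c
      (((prFst K K).comp (ι.toBase b)).comp (J i).incl)
      (((prSnd K K).comp (ι.toBase b)).comp (J i).incl)) :
    topologicalComplexity K.Realization ≤ k := by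
  refine sInf_le ⟨k, rfl,
    fun i => interior {p | (K.coverMap b p).concentrate.weight.support ∈ (J i).carrier},
    fun i => isOpen_interior, Set.eq_univ_of_forall fun p₀ => ?_, fun i => ?_⟩
  · obtain ⟨i, hi⟩ := hJ _ (K.coverMap b p₀).support_mem
    refine Set.mem_iUnion.2 ⟨i, mem_interior_iff_mem_nhds.2 ?_⟩
    have h := (K.tame_coverMap b).continuous.continuousAt.eventually
      (Realization.eventually_support_concentrate_subset (K.coverMap b p₀))
    filter_upwards [h] with p hp
    exact (J i).down_closed _ hi _ hp (nonempty_of_mem (K.coverMap b p).concentrate.support_mem)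
  · let S := {p | (K.coverMap b p).concentrate.weight.support ∈ (J i).carrier}
    let U := interior S
    let f : U → (J i).toComplex.Realization := fun p =>
      (J i).restrict (K.coverMap b p.1).concentrate (interior_subset (s := S) p.2)
    have hf : Tame fun p => (f p).weight := (J i).tame_restrict
      (Realization.tame_concentrate.comp
        ((K.tame_coverMap b).continuous.comp continuous_subtype_val)) _
    have hmem : ∀ (p : U), ∀ v ∈ (f p).weight.support,
        ((ι.toBase b).toFun v.1).1 ∈ p.1.1.concentrate.weight.support ∧
          ((ι.toBase b).toFun v.1).2 ∈ p.1.2.concentrate.weight.support := fun p v hv =>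
      toBase_mem_of_mem_support_coverMap ι (((J i).mem_support_restrict _ _ v).1 hv)
    let q : C(K.Realization, K.Realization) :=
      ⟨Realization.concentrate, Realization.tame_concentrate.continuous⟩
    have hq : (ContinuousMap.id _).Homotopic q :=
      homotopic_id_of_support_subset q Realization.support_concentrate_subset
    let p₁ : C(U, K.Realization) := ⟨fun p => p.1.1, continuous_fst.comp continuous_subtype_val⟩
    let p₂ : C(U, K.Realization) := ⟨fun p => p.1.2, continuous_snd.comp continuous_subtype_val⟩
    have h₁ : (q.comp p₁).Homotopic ⟨_, (SimplicialMap.tame_realize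
        (((prFst K K).comp (ι.toBase b)).comp (J i).incl) hf).continuous⟩ := by
      refine Tame.homotopic (Realization.tame_concentrate.comp p₁.continuous)
        (SimplicialMap.tame_realize _ hf) fun p => ?_
      change _ ∪ (SimplicialMap.realize _ (f p)).weight.support ∈ K.faces
      rw [SimplicialMap.support_realize, Finset.union_eq_left.2]
      · exact (q (p₁ p)).support_mem
      · exact Finset.image_subset_iff.2 fun v hv => (hmem p v hv).1
    have h₂ : (q.comp p₂).Homotopic ⟨_, (SimplicialMap.tame_realize
        (((prSnd K K).comp (ι.toBase b)).comp (J i).incl) hf).continuous⟩ := by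
      refine Tame.homotopic (Realization.tame_concentrate.comp p₂.continuous)
        (SimplicialMap.tame_realize _ hf) fun p => ?_
      change _ ∪ (SimplicialMap.realize _ (f p)).weight.support ∈ K.faces
      rw [SimplicialMap.support_realize, Finset.union_eq_left.2]
      · exact (q (p₂ p)).support_mem
      · exact Finset.image_subset_iff.2 fun v hv => (hmem p v hv).2
    have e₁ : p₁.Homotopic (q.comp p₁) := hq.comp (.refl p₁)
    have e₂ : p₂.Homotopic (q.comp p₂) := hq.comp (.refl p₂)
    exact exists_section_of_homotopic (f := p₁) (g := p₂) (fun _ => rfl) (fun _ => rfl)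
      ((e₁.trans h₁).trans (((hc i).homotopic hf).trans (e₂.trans h₂).symm))

end

end OrderedComplex

theorem propositionP (K : OrderedComplex.{u}) (ι : OrderedComplex.ApproxSystem (K.prod K))
    (b c : ℕ) :
    OrderedComplex.simpD ι b c (OrderedComplex.prFst K K) (OrderedComplex.prSnd K K) =
        K.simplicialComplexity ι b c ∧
      topologicalComplexity K.Realization ≤
        OrderedComplex.simpD ι b c (OrderedComplex.prFst K K) (OrderedComplex.prSnd K K) := by
  refine ⟨rfl, le_sInf ?_⟩
  rintro _ ⟨k, rfl, J, hJ, hc⟩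
  exact OrderedComplex.topologicalComplexity_le_of_covers ι J hJ hc
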